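/- **Setting.** Let $X=\mathbb{R}^d$ and $Y=\mathbb{R}$. A learner $A$ maps every finite sequence of labeled examples from $X\times Y$ to a function $X\to Y$. For a class $H$ of functions $X\to Y$ and $\varepsilon,\delta\in(0,1)$, say that sample size $n$ suffices for $A$ if, for every Borel probability measure $P$ on $X$ and every target $h\in H$, when $x_1,\dots,x_n$ are drawn i.i.d. from $P$, the output $g=A((x_1,h(x_1)),\dots,(x_n,h(x_n)))$ satisfies $P\{x: h(x)\ne g(x)\}\le\varepsilon$ with probability at least $1-\delta$. (If the event of failure is not measurable, this means that its outer probability is at most $\delta$.) The learner $A$ learns $H$ if for all $\varepsilon,\delta\in(0,1)$ there is an $m$ such that every sample size $n\ge m$ suffices; the least such $m$ is the sample complexity $m[A,H](\varepsilon,\delta)$. **Theorem.** There is a universal constant $C>0$ such that for every $d\in\mathbb{N}$ the class $H=\{x\mapsto\langle x,w\rangle : w\in\mathbb{R}^d\}$ of linear functions on $\mathbb{R}^d$ is learnable with sample complexity $O\left(\frac{d\log(d/\varepsilon)+\log(1/\delta)}{\varepsilon}\right)$ in the following sense. There is one learner $A$ (not depending on $\varepsilon,\delta$) that learns $H$ and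 satisfies, for all $\varepsilon,\delta\in(0,1)$, $$m[A,H](\varepsilon,\delta)\le\left\lceil C\,\frac{d\log(d/\varepsilon)+\log(1/\delta)}{\varepsilon}\right\rceil ,$$ and, whenever $d\neq 1$ or $\varepsilon\le\frac12$ or $\delta\le\frac12$, also $$m[A,H](\varepsilon,\delta)\le C\,\frac{d\log(d/\varepsilon)+\log(1/\delta)}{\varepsilon}.$$ Here $d\log(d/\varepsilon)$ is read as $0$ for $d=0$. -/

import Mathlib

open MeasureTheory Set

noncomputable section

namespace MultiClass

/-- The error of the hypothesis `h` with respect to the distribution `P` and the labeling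
function `l`: the probability that `h` and `l` disagree on a point drawn from `P`. -/
def err {X Y : Type*} [MeasurableSpace X] (P : Measure X) (l h : X → Y) : ENNReal :=
  P {x | l x ≠ h x}

/-- A learning algorithm: it maps every finite sequence of labeled examples to a hypothesis. -/
abbrev Learner (X Y : Type*) := (n : ℕ) → (Fin n → X × Y) → (X → Y)

/-- The sequence `x` of domain points, labeled by the function `h`. -/
def labeled {X Y : Type*} (h : X → Y) {n : ℕ} (x : Fin n → X) : Fin n → X × Y :=
  fun i => (x i, h (x i))

/-- For every distribution and every target in the class `H`, the output of `A` on `n` i.i.d.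
examples labeled by the target has error at most `ε` with probability at least `1 - δ`.
This is expressed by bounding the (outer) probability of failure by `δ`, which is the stronger
reading when the event of failure is not measurable. -/
def SucceedsOn {X Y : Type*} [MeasurableSpace X] (A : Learner X Y) (H : Set (X → Y))
    (ε δ : ℝ) (n : ℕ) : Prop :=
  ∀ P : Measure X, IsProbabilityMeasure P → ∀ h ∈ H,
    Measure.pi (fun _ : Fin n => P)
      {x | ¬ err P h (A n (labeled h x)) ≤ ENNReal.ofReal ε} ≤ ENNReal.ofReal δ

/-- `A` learns the class `H` (in the realizable case): there is a sample size function on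
`(0,1) × (0,1)` such that samples of at least that size suffice. -/
def Learns {X Y : Type*} [MeasurableSpace X] (A : Learner X Y) (H : Set (X → Y)) : Prop :=
  ∃ m : ℝ → ℝ → ℕ, ∀ ε ∈ Ioo (0 : ℝ) 1, ∀ δ ∈ Ioo (0 : ℝ) 1,
    ∀ n, m ε δ ≤ n → SucceedsOn A H ε δ n

/-- The sample complexity of the algorithm `A` for learning `H`: the least `m` such that all
samples of size at least `m` suffice. (Such an `m` exists whenever `A` learns `H`.) -/
def sampleComplexity {X Y : Type*} [MeasurableSpace X] (A : Learner X Y) (H : Set (X → Y))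
    (ε δ : ℝ) : ℕ :=
  sInf {m : ℕ | ∀ n, m ≤ n → SucceedsOn A H ε δ n}

/-- The class of linear functions `x ↦ ⟨x, w⟩` on `ℝ^d`. -/
def linearClass (d : ℕ) : Set (EuclideanSpace ℝ (Fin d) → ℝ) :=
  {h | ∃ w : EuclideanSpace ℝ (Fin d), h = fun x => inner ℝ x w}

/-- The rate `(d log (d / ε) + log (1 / δ)) / ε`; for `d = 0` the first summand is `0`. -/
def rate (d : ℕ) (ε δ : ℝ) : ℝ :=
  ((d : ℝ) * Real.log ((d : ℝ) / ε) + Real.log (1 / δ)) / ε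

end MultiClass

end

open MultiClass Module

/-! Any consistent linear function agrees with the target on the span of the sample, so its error is
at most the mass outside that span. If this mass exceeds `ε`, the span is proper, of dimension at
most `k = d - 1`, hence spanned by `k` sample points. The other points, at least `n - k` of them,
are independent of these and all fall in a subspace of mass at most `1 - ε`. A union bound over the
choices of `k` indices gives failure probability at most `n ^ k * (1 - ε) ^ (n - k)`
(`measure_pi_span_le`), and `pow_mul_one_sub_pow_le` converts this into the rate. -/

theorem exists_subsample_span_eq {K V : Type*} [DivisionRing K] [AddCommGroup V] [Module K V]
    {n k : ℕ} (hkn : k ≤ n) (x : Fin n → V)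
    (hx : finrank K (Submodule.span K (range x)) ≤ k) :
    ∃ s : Fin k → Fin n, Submodule.span K (range (x ∘ s)) = Submodule.span K (range x) := by
  have : FiniteDimensional K (Submodule.span K (range x)) :=
    FiniteDimensional.span_of_finite K (finite_range x)
  obtain ⟨f, hf, hspan, -⟩ := Submodule.exists_fun_fin_finrank_span_eq K (range x)
  choose g hg using hf
  -- Surplus slots are padded with arbitrary sample indices, which cannot enlarge the span.
  let s : Fin k → Fin n := fun i =>
    if h : (i : ℕ) < finrank K (Submodule.span K (range x)) then g ⟨i, h⟩ else Fin.castLE hkn i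
  refine ⟨s, le_antisymm (Submodule.span_mono (range_comp_subset_range _ _)) ?_⟩
  rw [← hspan]
  refine Submodule.span_mono ?_
  rintro _ ⟨i, rfl⟩
  exact ⟨Fin.castLE hx i, by simp [s, hg]⟩

/-! ### Mass missed by the span of a random sample -/

section Span

variable {E : Type*} [NormedAddCommGroup E] [NormedSpace ℝ E] [FiniteDimensional ℝ E]
  [MeasurableSpace E] [BorelSpace E]

/-- Parametrizing by coefficients shows the set to be a continuous image of a σ-compact space, hence
σ-compact and Borel. -/
theorem measurableSet_mem_span_range {ι κ : Type*} [Fintype ι] [Fintype κ] (s : κ → ι) :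
    MeasurableSet {q : (ι → E) × E | q.2 ∈ Submodule.span ℝ (range (q.1 ∘ s))} := by
  have : ProperSpace E := FiniteDimensional.proper_real E
  let f : (ι → E) × (κ → ℝ) → (ι → E) × E := fun q => (q.1, ∑ i, q.2 i • q.1 (s i))
  have hf : Continuous f := by fun_prop
  have hrange : {q : (ι → E) × E | q.2 ∈ Submodule.span ℝ (range (q.1 ∘ s))} = range f := by
    ext ⟨u, y⟩
    simp only [mem_ofPred_eq, Submodule.mem_span_range_iff_exists_fun, mem_range, Prod.exists,
      Function.comp_apply, f, Prod.mk.injEq]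
    constructor
    · rintro ⟨c, hc⟩
      exact ⟨u, c, rfl, hc⟩
    · rintro ⟨u, c, rfl, hc⟩
      exact ⟨c, hc⟩
  rw [hrange]
  obtain ⟨K, hK, hU⟩ := isSigmaCompact_range hf
  rw [← hU]
  exact MeasurableSet.iUnion fun i => (hK i).measurableSet

/-- The sample points outside the subsample `x ∘ s` are unlikely to all lie in the span of the
subsample when that span misses mass more than `ε`. -/
theorem measure_pi_subsample_span_le {n k : ℕ} (P : Measure E) [IsProbabilityMeasure P]
    (s : Fin k → Fin n) {ε : ℝ} (hε : 0 ≤ ε) (hε1 : ε ≤ 1) :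
    Measure.pi (fun _ : Fin n => P)
      {x | ENNReal.ofReal ε < P (Submodule.span ℝ (range (x ∘ s)) : Set E)ᶜ ∧
        ∀ j, x j ∈ Submodule.span ℝ (range (x ∘ s))} ≤ ENNReal.ofReal ((1 - ε) ^ (n - k)) := by
  classical
  -- Fubini: fixing the coordinates used by `s` fixes the subspace, and the rest stay independent of
  -- it.
  let p : Fin n → Prop := fun i => i ∈ range s
  let s' : Fin k → {i // p i} := fun i => ⟨s i, mem_range_self i⟩
  let W : ({i // p i} → E) → Submodule ℝ E := fun u => Submodule.span ℝ (range (u ∘ s'))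
  have hW : MeasurableSet {q : ({i // p i} → E) × E | q.2 ∈ W q.1} :=
    measurableSet_mem_span_range s'
  let T : Set (({i // p i} → E) × ({i // ¬ p i} → E)) :=
    {q | ENNReal.ofReal ε < P (W q.1 : Set E)ᶜ ∧ ∀ j, q.2 j ∈ W q.1}
  have hT : MeasurableSet T := by
    have h1 : Measurable fun u : {i // p i} → E => P (W u : Set E)ᶜ :=
      measurable_measure_prodMk_left hW.compl
    have h2 : MeasurableSet {q : ({i // p i} → E) × ({i // ¬ p i} → E) |
        ENNReal.ofReal ε < P (W q.1 : Set E)ᶜ} :=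
      measurableSet_lt measurable_const (h1.comp measurable_fst)
    have h3 : MeasurableSet {q : ({i // p i} → E) × ({i // ¬ p i} → E) |
        ∀ j, q.2 j ∈ W q.1} := by
      rw [ofPred_forall]
      refine MeasurableSet.iInter fun j => ?_
      have hg : Measurable fun q : ({i // p i} → E) × ({i // ¬ p i} → E) => (q.1, q.2 j) := by
        fun_prop
      exact hg hW
    exact h2.inter h3
  have hmp := measurePreserving_piEquivPiSubtypeProd (fun _ : Fin n => P) p
  have hsub : {x : Fin n → E |
      ENNReal.ofReal ε < P (Submodule.span ℝ (range (x ∘ s)) : Set E)ᶜ ∧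
        ∀ j, x j ∈ Submodule.span ℝ (range (x ∘ s))} ⊆
      MeasurableEquiv.piEquivPiSubtypeProd (fun _ : Fin n => E) p ⁻¹' T :=
    fun x hx => ⟨hx.1, fun j => hx.2 j⟩
  refine (measure_mono hsub).trans ?_
  rw [hmp.measure_preimage hT.nullMeasurableSet, Measure.prod_apply hT]
  have hcard : n - k ≤ Fintype.card {i // ¬ p i} := by
    have h1 : Fintype.card {i // p i} ≤ k := by
      have hs' : Function.Surjective s' := by
        rintro ⟨_, i, rfl⟩
        exact ⟨i, rfl⟩
      simpa using Fintype.card_le_of_surjective s' hs'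
    rw [Fintype.card_subtype_compl, Fintype.card_fin]
    omega
  have hbound : ∀ u, Measure.pi (fun _ : {i // ¬ p i} => P) (Prod.mk u ⁻¹' T) ≤
      ENNReal.ofReal ((1 - ε) ^ (n - k)) := by
    intro u
    by_cases hu : ENNReal.ofReal ε < P (W u : Set E)ᶜ
    · have hTu : Prod.mk u ⁻¹' T ⊆ Set.univ.pi fun _ => (W u : Set E) :=
        fun v hv j _ => hv.2 j
      refine (measure_mono hTu).trans ?_
      have hWm : MeasurableSet (W u : Set E) := (W u).closed_of_finiteDimensional.measurableSet
      have hP : P (W u : Set E) ≤ ENNReal.ofReal (1 - ε) := by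
        rw [← compl_compl (W u : Set E), prob_compl_eq_one_sub hWm.compl,
          ENNReal.ofReal_sub _ hε, ENNReal.ofReal_one]
        exact tsub_le_tsub_left hu.le _
      rw [Measure.pi_pi, Finset.prod_const, Finset.card_univ, ENNReal.ofReal_pow (by linarith)]
      exact (pow_le_pow_right_of_le_one' prob_le_one hcard).trans (by gcongr)
    · have hTu : Prod.mk u ⁻¹' T = ∅ := by
        ext v
        simp only [mem_preimage, mem_empty_iff_false, iff_false]
        exact fun hv => hu hv.1
      simp [hTu]
  refine (lintegral_mono hbound).trans ?_
  simp

/-- The probability that the span of an i.i.d. sample misses mass more than `ε`. -/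
theorem measure_pi_span_le {n k : ℕ} (hk : finrank ℝ E ≤ k + 1) (hkn : k ≤ n)
    (P : Measure E) [IsProbabilityMeasure P] {ε : ℝ} (hε : 0 ≤ ε) (hε1 : ε ≤ 1) :
    Measure.pi (fun _ : Fin n => P)
      {x | ENNReal.ofReal ε < P (Submodule.span ℝ (range x) : Set E)ᶜ} ≤
        ENNReal.ofReal ((n : ℝ) ^ k * (1 - ε) ^ (n - k)) := by
  have hsub : {x : Fin n → E | ENNReal.ofReal ε < P (Submodule.span ℝ (range x) : Set E)ᶜ} ⊆
      ⋃ s : Fin k → Fin n,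
        {x | ENNReal.ofReal ε < P (Submodule.span ℝ (range (x ∘ s)) : Set E)ᶜ ∧
          ∀ j, x j ∈ Submodule.span ℝ (range (x ∘ s))} := by
    intro x hx
    have hx' : ENNReal.ofReal ε < P (Submodule.span ℝ (range x) : Set E)ᶜ := hx
    have hne : Submodule.span ℝ (range x) ≠ ⊤ := by
      intro h
      simp [h] at hx'
    have hlt := Submodule.finrank_lt hne
    obtain ⟨s, hs⟩ := exists_subsample_span_eq (K := ℝ) hkn x (by omega)
    refine mem_iUnion.2 ⟨s, ?_⟩
    rw [mem_ofPred_eq, hs]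
    exact ⟨hx', fun j => Submodule.subset_span (mem_range_self j)⟩
  refine (measure_mono hsub).trans ((measure_iUnion_le _).trans ?_)
  rw [tsum_fintype]
  refine (Finset.sum_le_sum fun s _ => measure_pi_subsample_span_le P s hε hε1).trans ?_
  rw [Finset.sum_const, Finset.card_univ, Fintype.card_fun, Fintype.card_fin, Fintype.card_fin,
    nsmul_eq_mul, ENNReal.ofReal_mul (by positivity), ENNReal.ofReal_pow (by positivity)]
  simp

end Span

/-! ### The consistent learner -/

open Classical in
/-- The learner that outputs some linear function consistent with the sample, if there is one. -/
noncomputable def consistentLinearLearner (d : ℕ) : Learner (EuclideanSpace ℝ (Fin d)) ℝ := fun _ z =>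
  if h : ∃ w : EuclideanSpace ℝ (Fin d), ∀ i, inner ℝ (z i).1 w = (z i).2 then
    fun x => inner ℝ x h.choose
  else 0

theorem err_consistentLinearLearner_le {d n : ℕ} (P : Measure (EuclideanSpace ℝ (Fin d)))
    {h : EuclideanSpace ℝ (Fin d) → ℝ} (hh : h ∈ linearClass d)
    (x : Fin n → EuclideanSpace ℝ (Fin d)) :
    err P h (consistentLinearLearner d n (labeled h x)) ≤
      P (Submodule.span ℝ (range x) : Set (EuclideanSpace ℝ (Fin d)))ᶜ := by
  obtain ⟨w, rfl⟩ := hh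
  have hex : ∃ v : EuclideanSpace ℝ (Fin d),
      ∀ i, inner ℝ (labeled (fun y => inner ℝ y w) x i).1 v =
        (labeled (fun y => inner ℝ y w) x i).2 := ⟨w, fun i => rfl⟩
  have hv : ∀ i, inner ℝ (x i) hex.choose = inner ℝ (x i) w := hex.choose_spec
  rw [consistentLinearLearner, dif_pos hex]
  refine measure_mono fun y hy hmem => hy ?_
  change inner ℝ y w = inner ℝ y hex.choose
  clear hy
  induction hmem using Submodule.span_induction with
  | mem y hy =>
    obtain ⟨i, rfl⟩ := hy
    exact (hv i).symm
  | zero => simp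
  | add y z _ _ h1 h2 => rw [inner_add_left, inner_add_left, h1, h2]
  | smul a y _ h1 => rw [real_inner_smul_left, real_inner_smul_left, h1]

theorem succeedsOn_consistentLinearLearner {d n k : ℕ} (hd : d ≤ k + 1) (hkn : k ≤ n) {ε δ : ℝ}
    (hε : 0 ≤ ε) (hε1 : ε ≤ 1) (hδ : (n : ℝ) ^ k * (1 - ε) ^ (n - k) ≤ δ) :
    SucceedsOn (consistentLinearLearner d) (linearClass d) ε δ n := by
  intro P _ h hh
  refine le_trans (measure_mono fun x hx => ?_) ((measure_pi_span_le (k := k)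
    (by simpa using hd) hkn P hε hε1).trans (ENNReal.ofReal_le_ofReal hδ))
  exact (not_le.1 hx).trans_le (err_consistentLinearLearner_le P hh x)

theorem succeedsOn_consistentLinearLearner_zero (n : ℕ) (ε δ : ℝ) :
    SucceedsOn (consistentLinearLearner 0) (linearClass 0) ε δ n := by
  intro P _ h hh
  have hempty : {x | ¬ err P h (consistentLinearLearner 0 n (labeled h x)) ≤
      ENNReal.ofReal ε} = ∅ := by
    refine eq_empty_of_forall_notMem fun x hx => hx ?_
    refine (err_consistentLinearLearner_le P hh x).trans ?_
    rw [Subsingleton.elim (Submodule.span ℝ (range x)) ⊤]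
    simp
  rw [hempty, measure_empty]
  exact bot_le

/-! ### From the failure bound to the rate -/

theorem half_le_log_of_two_le {x : ℝ} (hx : 2 ≤ x) : 1 / 2 ≤ Real.log x := by
  have := Real.log_two_gt_d9
  have := Real.log_le_log (by norm_num) hx
  linarith

theorem pow_mul_one_sub_pow_le {n k : ℕ} {ε δ : ℝ} (hε : ε ∈ Ioo (0 : ℝ) 1)
    (hδ : δ ∈ Ioo (0 : ℝ) 1) (hn : 8 * rate (k + 1) ε δ ≤ n) :
    k ≤ n ∧ (n : ℝ) ^ k * (1 - ε) ^ (n - k) ≤ δ := by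
  obtain ⟨hε0, hε1⟩ := hε
  obtain ⟨hδ0, hδ1⟩ := hδ
  have hlogδ : 0 < Real.log (1 / δ) := Real.log_pos (by rw [lt_div_iff₀ hδ0]; linarith)
  have hlogδ' : Real.log (1 / δ) = -Real.log δ := by simp
  set L := Real.log (((k + 1 : ℕ) : ℝ) / ε) with hL
  have hL0 : 0 ≤ L := by
    refine Real.log_nonneg ?_
    rw [le_div_iff₀ hε0]
    push_cast
    have : (0 : ℝ) ≤ k := k.cast_nonneg
    linarith
  have hn' : 8 * (((k + 1 : ℕ) : ℝ) * L + Real.log (1 / δ)) ≤ n * ε := by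
    rw [rate, ← mul_div_assoc, div_le_iff₀ hε0] at hn
    exact hn
  push_cast at hn'
  have hkL : (0 : ℝ) ≤ k * L := by positivity
  have hnpos : (0 : ℝ) < n := by
    by_contra h
    nlinarith
  -- For `k ≥ 1`, `(k + 1) / ε ≥ 2` gives `L ≥ 1 / 2`; `log n` is bounded by applying `log t ≤ t` at
  -- `t = n * ε / (4 * k)`.
  have hk2 : (k : ℝ) ≤ 2 * (k * L) ∧ (k : ℝ) * Real.log n ≤ n * ε / 4 + 3 * (k * L) := by
    rcases Nat.eq_zero_or_pos k with rfl | hk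
    · simp; positivity
    have hk1 : (1 : ℝ) ≤ k := by exact_mod_cast hk
    have hq : 2 ≤ ((k + 1 : ℕ) : ℝ) / ε := by
      rw [le_div_iff₀ hε0]; push_cast; linarith
    have hLhalf : 1 / 2 ≤ L := half_le_log_of_two_le hq
    refine ⟨by nlinarith, ?_⟩
    have h1 : Real.log (n * ε / (4 * k)) ≤ n * ε / (4 * k) := by
      have := Real.log_le_sub_one_of_pos (x := n * ε / (4 * k)) (by positivity)
      linarith
    have h2 : Real.log (4 * k / ε) ≤ 3 * L := by
      have : 3 * L = Real.log ((((k + 1 : ℕ) : ℝ) / ε) ^ 3) := by rw [Real.log_pow]; norm_num [hL]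
      rw [this]
      refine Real.log_le_log (by positivity) ?_
      have h4 : 4 * k / ε ≤ 4 * (((k + 1 : ℕ) : ℝ) / ε) := by
        rw [mul_div_assoc]; gcongr; linarith
      -- `4 * q ≤ q ^ 3` for `q ≥ 2`.
      nlinarith [mul_self_nonneg (((k + 1 : ℕ) : ℝ) / ε - 2)]
    have h3 : Real.log n = Real.log (n * ε / (4 * k)) + Real.log (4 * k / ε) := by
      rw [← Real.log_mul (by positivity) (by positivity)]
      congr 1
      field_simp
    calc (k : ℝ) * Real.log n ≤ k * (n * ε / (4 * k) + 3 * L) := by rw [h3]; gcongr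
      _ = n * ε / 4 + 3 * (k * L) := by field_simp
  have hkn : k ≤ n := by
    have : (k : ℝ) ≤ n := by nlinarith [hk2.1]
    exact_mod_cast this
  refine ⟨hkn, ?_⟩
  have hexp : (1 - ε) ^ (n - k) ≤ Real.exp (-(ε * (n - k))) := by
    calc (1 - ε) ^ (n - k) ≤ Real.exp (-ε) ^ (n - k) := by
          exact pow_le_pow_left₀ (by linarith) (Real.one_sub_le_exp_neg ε) _
      _ = Real.exp (-(ε * (n - k))) := by
          rw [← Real.exp_nat_mul, Nat.cast_sub hkn]
          ring_nf
  have hpow : (n : ℝ) ^ k = Real.exp (k * Real.log n) := by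
    rw [Real.exp_nat_mul, Real.exp_log hnpos]
  calc (n : ℝ) ^ k * (1 - ε) ^ (n - k)
      ≤ Real.exp (k * Real.log n) * Real.exp (-(ε * (n - k))) := by rw [hpow]; gcongr
    _ = Real.exp (k * Real.log n + -(ε * (n - k))) := (Real.exp_add _ _).symm
    _ ≤ Real.exp (Real.log δ) := by
        refine Real.exp_le_exp.2 ?_
        have hεk : ε * k ≤ k := mul_le_of_le_one_left k.cast_nonneg hε1.le
        -- The two bounds cost `5 * k * L`, while `3 / 4` of `n * ε` supplies at least `6 * (k * L +
        -- log (1 / δ))`.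
        nlinarith [hk2.1, hk2.2]
    _ = δ := Real.exp_log hδ0

theorem rate_nonneg (d : ℕ) {ε δ : ℝ} (hε : ε ∈ Ioo (0 : ℝ) 1) (hδ : δ ∈ Ioo (0 : ℝ) 1) :
    0 ≤ rate d ε δ := by
  have hlogδ : 0 ≤ Real.log (1 / δ) :=
    Real.log_nonneg (by rw [le_div_iff₀ hδ.1]; linarith [hδ.2])
  have hd : 0 ≤ (d : ℝ) * Real.log ((d : ℝ) / ε) := by
    rcases Nat.eq_zero_or_pos d with rfl | hd
    · simp
    have hd1 : (1 : ℝ) ≤ d := by exact_mod_cast hd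
    have : 0 ≤ Real.log ((d : ℝ) / ε) :=
      Real.log_nonneg (by rw [le_div_iff₀ hε.1]; linarith [hε.2])
    positivity
  exact div_nonneg (by linarith) hε.1.le

/-- One of the two logarithms has argument at least `2`. In the excluded case, `d = 1` with `ε` and
`δ` near `1`, the rate tends to `0`. -/
theorem half_le_rate {d : ℕ} (hd : d ≠ 0) {ε δ : ℝ} (hε : ε ∈ Ioo (0 : ℝ) 1)
    (hδ : δ ∈ Ioo (0 : ℝ) 1) (h : d ≠ 1 ∨ ε ≤ 1 / 2 ∨ δ ≤ 1 / 2) : 1 / 2 ≤ rate d ε δ := by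
  obtain ⟨hε0, hε1⟩ := hε
  obtain ⟨hδ0, hδ1⟩ := hδ
  have hd1 : (1 : ℝ) ≤ d := by exact_mod_cast Nat.one_le_iff_ne_zero.2 hd
  have hlogδ : 0 ≤ Real.log (1 / δ) :=
    Real.log_nonneg (by rw [le_div_iff₀ hδ0]; linarith)
  have hlogd : 0 ≤ Real.log ((d : ℝ) / ε) :=
    Real.log_nonneg (by rw [le_div_iff₀ hε0]; linarith)
  have hnum : 1 / 2 ≤ (d : ℝ) * Real.log ((d : ℝ) / ε) + Real.log (1 / δ) := by
    have key : 2 ≤ (d : ℝ) / ε ∨ 2 ≤ 1 / δ := by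
      rcases h with h | h | h
      · left
        have : (2 : ℝ) ≤ d := by exact_mod_cast (show 2 ≤ d by omega)
        rw [le_div_iff₀ hε0]; linarith
      · left
        rw [le_div_iff₀ hε0]; linarith
      · right
        rw [le_div_iff₀ hδ0]; linarith
    rcases key with h | h
    · nlinarith [half_le_log_of_two_le h]
    · nlinarith [half_le_log_of_two_le h, mul_nonneg (zero_le_one.trans hd1) hlogd]
  rw [rate, le_div_iff₀ hε0]
  linarith

theorem succeedsOn_of_rate_le {d n : ℕ} {ε δ : ℝ} (hε : ε ∈ Ioo (0 : ℝ) 1)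
    (hδ : δ ∈ Ioo (0 : ℝ) 1) (hn : 8 * rate d ε δ ≤ n) :
    SucceedsOn (consistentLinearLearner d) (linearClass d) ε δ n := by
  cases d with
  | zero => exact succeedsOn_consistentLinearLearner_zero n ε δ
  | succ k =>
    obtain ⟨hkn, hle⟩ := pow_mul_one_sub_pow_le hε hδ hn
    exact succeedsOn_consistentLinearLearner le_rfl hkn hε.1.le hε.2.le hle

theorem mainTheorem12 :
    ∃ C : ℝ, 0 < C ∧ ∀ d : ℕ,
      ∃ A : MultiClass.Learner (EuclideanSpace ℝ (Fin d)) ℝ,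
        MultiClass.Learns A (MultiClass.linearClass d) ∧
        ∀ ε ∈ Set.Ioo (0 : ℝ) 1, ∀ δ ∈ Set.Ioo (0 : ℝ) 1,
          MultiClass.sampleComplexity A (MultiClass.linearClass d) ε δ
              ≤ ⌈C * MultiClass.rate d ε δ⌉₊ ∧
          ((d ≠ 1 ∨ ε ≤ 1 / 2 ∨ δ ≤ 1 / 2) →
            (MultiClass.sampleComplexity A (MultiClass.linearClass d) ε δ : ℝ)
              ≤ C * MultiClass.rate d ε δ) := by
  -- `10 = 8 + 2`: a rate of at least `1 / 2` lets `2 * rate` absorb the `1` lost in rounding up.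
  refine ⟨10, by norm_num, fun d => ⟨consistentLinearLearner d,
    ⟨fun ε δ => ⌈8 * rate d ε δ⌉₊, fun ε hε δ hδ n hn =>
      succeedsOn_of_rate_le hε hδ (Nat.ceil_le.1 hn)⟩, fun ε hε δ hδ => ?_⟩⟩
  have hR := rate_nonneg d hε hδ
  have hle : sampleComplexity (consistentLinearLearner d) (linearClass d) ε δ ≤
      ⌈8 * rate d ε δ⌉₊ :=
    Nat.sInf_le fun n hn => succeedsOn_of_rate_le hε hδ (Nat.ceil_le.1 hn)
  refine ⟨hle.trans (Nat.ceil_mono (by linarith)), fun h => ?_⟩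
  rcases Nat.eq_zero_or_pos d with rfl | hd
  · have h0 : sampleComplexity (consistentLinearLearner 0) (linearClass 0) ε δ ≤ 0 :=
      Nat.sInf_le fun n _ => succeedsOn_consistentLinearLearner_zero n ε δ
    rw [Nat.le_zero.1 h0, Nat.cast_zero]
    positivity
  · have hhalf := half_le_rate hd.ne' hε hδ h
    have hceil := Nat.ceil_lt_add_one (show 0 ≤ 8 * rate d ε δ by positivity)
    have : (sampleComplexity (consistentLinearLearner d) (linearClass d) ε δ : ℝ) ≤
      ⌈8 * rate d ε δ⌉₊ := by exact_mod_cast hle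
    linarith
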